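/- **Setting.** Let $(Y,d,\mu)$ be a Hölder doubling quasi-metric space. That is, $d:Y\times Y\to[0,\infty)$ is symmetric, $d(x,y)=0$ iff $x=y$, and there are $K_0\ge 1$, $\beta>0$, $0<\alpha\le1$ with $d(x,y)\le K_0(d(x,z)+d(z,y))$ and $|d(x,y)-d(x,z)|\le\beta\, d(y,z)^{\alpha}(d(x,y)+d(x,z))^{1-\alpha}$ for all $x,y,z$; and $\mu$ is a positive measure on a $\sigma$-algebra containing the balls $B_r(x)=\{y: d(x,y)<r\}$, every member of which agrees, up to a $\mu$-null set, with a set of the $\sigma$-algebra generated by the balls, such that for some $C_D>0$, $0<\mu(B_{2r}(x))\le C_D\,\mu(B_r(x))$ for all $x\in Y$, $r>0$. Let $\Omega\subseteq Y$ be open. Let $\mathcal S(B,f)\in[0,\infty]$ be defined for balls $B\subseteq\Omega$ and measurable $f:\Omega\to\mathbb R$, with $\mathcal S(B,f)\le \mathcal S(B',f)$ if $B\subseteq B'$, and $\mathcal S(B,\lambda f)=|\lambda|\,\mathcal S(B,f)$ for $\lambda\in\mathbb R$ (with $0\cdot\infty=0$). Let $\mathcal L(\Omega)$ be the set of measurable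 $f:\Omega\to\mathbb R$ with $\mathcal S(B,f)<\infty$ for all balls $B\subseteq\Omega$. For each $f\in\mathcal L(\Omega)$ let $\mathbb K_{\Omega,f}$ be a set of non-negative measurable functions $u:A\to\mathbb R$, $A\subseteq\Omega$ ($A$ may depend on $u$), such that, for $u\in\mathbb K_{\Omega,f}$: $\lambda u\in\mathbb K_{\Omega,\lambda f}$ for all $\lambda\ge0$, and $\tau-\lambda u\in\mathbb K_{\Omega,-\lambda f}$ for all $\lambda,\tau\ge0$ with $\tau-\lambda u\ge0$. Write $u\in\mathbb K_{\Omega,f}(A')$ if $u\in\mathbb K_{\Omega,f}$ and the domain of $u$ contains $A'$. Below, $B_R=B_R(x_0)$ with arbitrary $x_0$ and $R>0$, and all constants are *structural*: they do not depend on $f\in\mathcal L(\Omega)$, on the balls, or on $u$. * *Double ball property*: there are $0<\gamma,\varepsilon<1$ and $\eta>1$ such that, for all $f\in\mathcal L(\Omega)$, $B_{\eta R}\subseteq\Omega$ and $u\in\mathbb K_{\Omega,f}(B_{\eta R})$, if $\inf_{B_{R/2}}u\ge1$ and $\mathcal S(B_{\eta R},f)<\varepsilon$, then $\inf_{B_R}u\ge\gamma$.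 * *$\nu$-critical density property* ($0<\nu<1$): there are $0<c,\varepsilon<1$ and $\eta>1$ such that, for all $f\in\mathcal L(\Omega)$, $B_{\eta R}\subseteq\Omega$ and $u\in\mathbb K_{\Omega,f}(B_{\eta R})$, if $\mu(\{x\in B_R:u(x)\ge1\})\ge\nu\,\mu(B_R)$, then $\inf_{B_{R/2}}u\ge c$ or $\mathcal S(B_{\eta R},f)\ge\varepsilon$. * *Power decay property*: there are $0\le\gamma<1$, $0<\varepsilon_P<1$ and $\eta_P,M>1$ such that, for all $f\in\mathcal L(\Omega)$, $B_{\eta_PR}\subseteq\Omega$ and $u\in\mathbb K_{\Omega,f}(B_{\eta_PR})$, if $\inf_{B_R}u\le1$ and $\mathcal S(B_{\eta_PR},f)<\varepsilon_P$, then $\mu(\{x\in B_{R/2}:u(x)>M^k\})\le\gamma^k\mu(B_{R/2})$ for all $k\in\mathbb N$. **Theorem 2.1 (Power decay).** Suppose there is $0<\delta<1$ with $\mu(B_r(x))\le\delta\,\mu(B_{2r}(x))$ for every $B_{2r}(x)\subseteq\Omega$, let $0<\nu<1$, and suppose that (A) or (B) holds: * (A) the families $\mathbb K_{\Omega,f}$,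 $f\in\mathcal L(\Omega)$, have the double ball property and the $\nu$-critical density property, and $(Y,d,\mu)$ satisfies the ring condition with $\omega(s)=o(\log^{-2}(1/s))$ as $s\to0^+$: there are $\omega\ge0$ with $\omega(s)\to0$ and $\omega(s)=o(\log^{-2}(1/s))$ as $s\to0^+$, and $s_0>0$, with $\mu(B_r(x)\setminus B_{(1-s)r}(x))\le\omega(s)\,\mu(B_r(x))$ for all $x\in Y$, $r>0$ and $0<s<s_0$; * (B) the families $\mathbb K_{\Omega,f}$, $f\in\mathcal L(\Omega)$, have the $\nu$-critical density property, $\nu<1/C_D^2$, and for every $x\in Y$ the function $r\mapsto\mu(B_r(x))$ is continuous on $(0,\infty)$. Then the families $\mathbb K_{\Omega,f}$, $f\in\mathcal L(\Omega)$, have the power decay property. -/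

import Mathlib

open MeasureTheory Filter Topology Set
open scoped ENNReal

namespace NonhomHarnack

/-- The `d`-ball `B_r(x) = {y : d(x,y) < r}`. -/
def qball {Y : Type*} (d : Y → Y → ℝ) (x : Y) (r : ℝ) : Set Y := {y | d x y < r}

/-- `d` is a quasi distance on `Y`. -/
structure IsQuasiDist {Y : Type*} (d : Y → Y → ℝ) : Prop where
  nonneg : ∀ x y, 0 ≤ d x y
  symm : ∀ x y, d x y = d y x
  eq_zero_iff : ∀ x y, d x y = 0 ↔ x = y
  quasi_triangle : ∃ K : ℝ, 1 ≤ K ∧ ∀ x y z, d x y ≤ K * (d x z + d z y)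

/-- `d` is a Hölder continuous quasi distance. -/
structure IsHolderQuasiDist {Y : Type*} (d : Y → Y → ℝ) : Prop extends IsQuasiDist d where
  holder : ∃ β α : ℝ, 0 < β ∧ 0 < α ∧ α ≤ 1 ∧
    ∀ x y z, |d x y - d x z| ≤ β * d y z ^ α * (d x y + d x z) ^ (1 - α)

/-- `Ω` is open for the topology in which the `d`-balls are bases of neighborhoods. -/
def IsQOpen {Y : Type*} (d : Y → Y → ℝ) (Ω : Set Y) : Prop :=
  ∀ x ∈ Ω, ∃ r : ℝ, 0 < r ∧ qball d x r ⊆ Ω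

/-- The σ-algebra on which `μ` is defined contains the `d`-balls, and each of its members coincides
up to a `μ`-null set with a member of the σ-algebra generated by the `d`-balls (this holds for the
Borel sets of `d` and for their `μ`-completion). -/
structure IsRegularMeasure {Y : Type*} [MeasurableSpace Y] (d : Y → Y → ℝ) (μ : Measure Y) :
    Prop where
  measurableSet_ball : ∀ x r, MeasurableSet (qball d x r)
  exists_ae_eq : ∀ A : Set Y, MeasurableSet A →
    ∃ B : Set Y, MeasurableSet[MeasurableSpace.generateFrom {s | ∃ x r, s = qball d x r}] B ∧
      A =ᵐ[μ] B

/-- The doubling property, with doubling constant `C_D`. -/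
structure IsDoubling {Y : Type*} [MeasurableSpace Y] (d : Y → Y → ℝ) (μ : Measure Y) (C_D : ℝ) :
    Prop where
  const_pos : 0 < C_D
  ball_pos : ∀ x r, 0 < r → 0 < μ (qball d x (2 * r))
  doubling : ∀ x r, 0 < r → μ (qball d x (2 * r)) ≤ ENNReal.ofReal C_D * μ (qball d x r)

/-- The ring condition, with rate function `ω`. -/
structure RingCondition {Y : Type*} [MeasurableSpace Y] (d : Y → Y → ℝ) (μ : Measure Y)
    (ω : ℝ → ℝ) : Prop where
  nonneg : ∀ s, 0 < s → 0 ≤ ω s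
  tendsto_zero : Tendsto ω (𝓝[>] 0) (𝓝 0)
  ring : ∃ s₀ : ℝ, 0 < s₀ ∧ ∀ s, 0 < s → s < s₀ → ∀ x r, 0 < r →
    μ (qball d x r \ qball d x ((1 - s) * r)) ≤ ENNReal.ofReal (ω s) * μ (qball d x r)

/-- A real function `u : A → ℝ` defined on a subset `A` of `Y`. -/
structure PartialFun (Y : Type*) where
  dom : Set Y
  toFun : dom → ℝ

namespace PartialFun

variable {Y : Type*}

/-- `λ u`, with the domain of `u`. -/
def smul (l : ℝ) (u : PartialFun Y) : PartialFun Y := ⟨u.dom, fun x => l * u.toFun x⟩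

/-- `τ - λ u`, with the domain of `u`. -/
def subSmul (t l : ℝ) (u : PartialFun Y) : PartialFun Y := ⟨u.dom, fun x => t - l * u.toFun x⟩

/-- `{u ≥ t}`. -/
def superlevel (u : PartialFun Y) (t : ℝ) : Set Y := {x | ∃ h : x ∈ u.dom, t ≤ u.toFun ⟨x, h⟩}

/-- `{u > t}`. -/
def strictSuperlevel (u : PartialFun Y) (t : ℝ) : Set Y :=
  {x | ∃ h : x ∈ u.dom, t < u.toFun ⟨x, h⟩}

/-- `inf_B u`; it is used only for `u ≥ 0` and for nonempty `B` contained in the domain of `u`. -/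
noncomputable def infOn (u : PartialFun Y) (B : Set Y) : ℝ :=
  sInf {t | ∃ (x : Y) (h : x ∈ u.dom), x ∈ B ∧ u.toFun ⟨x, h⟩ = t}

end PartialFun

/-- The requirements on the function `S_Ω`, defined on the balls contained in `Ω` and the measurable
functions on `Ω`: monotone in the ball, absolutely homogeneous in the function. -/
structure IsSizeFunctional {Y : Type*} [MeasurableSpace Y] (d : Y → Y → ℝ) (Ω : Set Y)
    (S : Set Y → (Ω → ℝ) → ℝ≥0∞) : Prop where
  mono : ∀ f : Ω → ℝ, Measurable f → ∀ x y r R, 0 < r → 0 < R →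
    qball d x R ⊆ Ω → qball d y r ⊆ qball d x R → S (qball d y r) f ≤ S (qball d x R) f
  homog : ∀ f : Ω → ℝ, Measurable f → ∀ (l : ℝ) (x : Y) (r : ℝ), 0 < r → qball d x r ⊆ Ω →
    S (qball d x r) (fun y => l * f y) = ENNReal.ofReal |l| * S (qball d x r) f

/-- The class `L(Ω)` of the measurable functions on `Ω` with `S_Ω(B, f) < ∞` for all balls
`B ⊆ Ω`. -/
def classL {Y : Type*} [MeasurableSpace Y] (d : Y → Y → ℝ) (Ω : Set Y)
    (S : Set Y → (Ω → ℝ) → ℝ≥0∞) : Set (Ω → ℝ) :=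
  {f | Measurable f ∧ ∀ x r, 0 < r → qball d x r ⊆ Ω → S (qball d x r) f < ∞}

/-- The requirements on the families `K_{Ω,f}`, `f ∈ L(Ω)`. -/
structure IsAdmissibleFamily {Y : Type*} [MeasurableSpace Y] (d : Y → Y → ℝ) (Ω : Set Y)
    (S : Set Y → (Ω → ℝ) → ℝ≥0∞) (K : (Ω → ℝ) → Set (PartialFun Y)) : Prop where
  dom_subset : ∀ f ∈ classL d Ω S, ∀ u ∈ K f, u.dom ⊆ Ω
  nonneg : ∀ f ∈ classL d Ω S, ∀ u ∈ K f, ∀ x, 0 ≤ u.toFun x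
  measurable : ∀ f ∈ classL d Ω S, ∀ u ∈ K f, Measurable u.toFun
  smul_mem : ∀ f ∈ classL d Ω S, ∀ u ∈ K f, ∀ l : ℝ, 0 ≤ l →
    u.smul l ∈ K (fun y => l * f y)
  subSmul_mem : ∀ f ∈ classL d Ω S, ∀ u ∈ K f, ∀ l t : ℝ, 0 ≤ l → 0 ≤ t →
    (∀ x, 0 ≤ t - l * u.toFun x) → PartialFun.subSmul t l u ∈ K (fun y => -l * f y)

section Properties

variable {Y : Type*} [MeasurableSpace Y]

/-- The `ν` critical density property `CD(ν, c, ε, η)` of the single family `K_{Ω,f}`. -/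
def CriticalDensity (d : Y → Y → ℝ) (μ : Measure Y) (Ω : Set Y) (S : Set Y → (Ω → ℝ) → ℝ≥0∞)
    (K : (Ω → ℝ) → Set (PartialFun Y)) (f : Ω → ℝ) (ν c ε η : ℝ) : Prop :=
  ∀ (x₀ : Y) (R : ℝ), 0 < R → qball d x₀ (η * R) ⊆ Ω →
    ∀ u ∈ K f, qball d x₀ (η * R) ⊆ u.dom →
      ENNReal.ofReal ν * μ (qball d x₀ R) ≤ μ (qball d x₀ R ∩ u.superlevel 1) →
        c ≤ u.infOn (qball d x₀ (R / 2)) ∨ ENNReal.ofReal ε ≤ S (qball d x₀ (η * R)) f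

/-- The double ball property `DB(γ, ε, η)` of the single family `K_{Ω,f}`. -/
def DoubleBall (d : Y → Y → ℝ) (Ω : Set Y) (S : Set Y → (Ω → ℝ) → ℝ≥0∞)
    (K : (Ω → ℝ) → Set (PartialFun Y)) (f : Ω → ℝ) (γ ε η : ℝ) : Prop :=
  ∀ (x₀ : Y) (R : ℝ), 0 < R → qball d x₀ (η * R) ⊆ Ω →
    ∀ u ∈ K f, qball d x₀ (η * R) ⊆ u.dom →
      1 ≤ u.infOn (qball d x₀ (R / 2)) → S (qball d x₀ (η * R)) f < ENNReal.ofReal ε →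
        γ ≤ u.infOn (qball d x₀ R)

/-- The power decay property `PD(M, γ, ε, η)` of the single family `K_{Ω,f}`. -/
def PowerDecay (d : Y → Y → ℝ) (μ : Measure Y) (Ω : Set Y) (S : Set Y → (Ω → ℝ) → ℝ≥0∞)
    (K : (Ω → ℝ) → Set (PartialFun Y)) (f : Ω → ℝ) (M γ ε η : ℝ) : Prop :=
  ∀ (x₀ : Y) (R : ℝ), 0 < R → qball d x₀ (η * R) ⊆ Ω →
    ∀ u ∈ K f, qball d x₀ (η * R) ⊆ u.dom →
      u.infOn (qball d x₀ R) ≤ 1 → S (qball d x₀ (η * R)) f < ENNReal.ofReal ε →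
        ∀ k : ℕ, μ (qball d x₀ (R / 2) ∩ u.strictSuperlevel (M ^ k)) ≤
          ENNReal.ofReal (γ ^ k) * μ (qball d x₀ (R / 2))

/-- The families `K_{Ω,f}`, `f ∈ L(Ω)`, have the `ν` critical density property with structural
constants, that is, constants independent of `f`, of the balls and of `u`. -/
def HasCriticalDensity (d : Y → Y → ℝ) (μ : Measure Y) (Ω : Set Y) (S : Set Y → (Ω → ℝ) → ℝ≥0∞)
    (K : (Ω → ℝ) → Set (PartialFun Y)) (ν : ℝ) : Prop :=
  ∃ c ε η : ℝ, 0 < c ∧ c < 1 ∧ 0 < ε ∧ ε < 1 ∧ 1 < η ∧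
    ∀ f ∈ classL d Ω S, CriticalDensity d μ Ω S K f ν c ε η

/-- The families `K_{Ω,f}`, `f ∈ L(Ω)`, have the double ball property with structural constants. -/
def HasDoubleBall (d : Y → Y → ℝ) (Ω : Set Y) (S : Set Y → (Ω → ℝ) → ℝ≥0∞)
    (K : (Ω → ℝ) → Set (PartialFun Y)) : Prop :=
  ∃ γ ε η : ℝ, 0 < γ ∧ γ < 1 ∧ 0 < ε ∧ ε < 1 ∧ 1 < η ∧
    ∀ f ∈ classL d Ω S, DoubleBall d Ω S K f γ ε η

/-- The families `K_{Ω,f}`, `f ∈ L(Ω)`, have the power decay property with structural constants. -/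
def HasPowerDecay (d : Y → Y → ℝ) (μ : Measure Y) (Ω : Set Y) (S : Set Y → (Ω → ℝ) → ℝ≥0∞)
    (K : (Ω → ℝ) → Set (PartialFun Y)) : Prop :=
  ∃ M γ ε η : ℝ, 1 < M ∧ 0 ≤ γ ∧ γ < 1 ∧ 0 < ε ∧ ε < 1 ∧ 1 < η ∧
    ∀ f ∈ classL d Ω S, PowerDecay d μ Ω S K f M γ ε η

end Properties

end NonhomHarnack

namespace NonhomHarnack

variable {Y : Type*} {d : Y → Y → ℝ}

/-! Let `E k` be the part of the ball of radius `R / 2 * (1 + 2⁻ᵏ)` where `u > M ^ k`. The aim is `μ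
(E (k + 1)) ≤ θ * μ (E k)` with `θ < 1`. By a weak Lebesgue density theorem (`ae_exists_density`),
almost every `x ∈ E (k + 1)` is the center of a ball of radius `R / 2 ^ j` in which `E (k + 1)` has
proportion at least `ν`; take the largest such ball. Critical density bounds `u` below on its half,
and iterated doubling carries the bound to a ball containing `B_R(x₀)`. As `inf u ≤ 1` there, the
radius must be geometrically small in `k` (`level_le_one`). The ball of twice the radius then stays
in the domain of `E k` by Hölder continuity of `d`, and two doublings give `u > M ^ k` on it, so it
lies in `E k`; by maximality `E (k + 1)` fills less than `ν` of it. A Vitali covering by these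
doubled balls bounds `μ (E (k + 1))` by a multiple of `μ (E k \ E (k + 1))`, which is the decay.
Homogeneity in `u` and `f` gives both properties at all levels `t ≥ 1`. In case (B) the double ball
property comes from critical density on a ball of twice the radius. -/

theorem mem_qball {x y : Y} {r : ℝ} : y ∈ qball d x r ↔ d x y < r := Iff.rfl

theorem qball_subset_qball {x : Y} {r s : ℝ} (h : r ≤ s) : qball d x r ⊆ qball d x s :=
  fun _ hy => lt_of_lt_of_le hy h

theorem IsQuasiDist.mem_qball_self (hd : IsQuasiDist d) (x : Y) {r : ℝ} (hr : 0 < r) :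
    x ∈ qball d x r := by
  rw [mem_qball, (hd.eq_zero_iff x x).2 rfl]
  exact hr

/-! ### Open sets and ball inclusions for a Hölder quasi distance -/

/-- A Hölder quasi distance is continuous in its second variable. -/
theorem IsHolderQuasiDist.exists_abs_sub_lt (hd : IsHolderQuasiDist d) (x₀ x : Y) {τ : ℝ}
    (hτ : 0 < τ) : ∃ s, 0 < s ∧ ∀ y ∈ qball d x s, |d x₀ x - d x₀ y| < τ := by
  obtain ⟨K, hK, htri⟩ := hd.quasi_triangle
  obtain ⟨β, α, hβ, hα, hα1, hol⟩ := hd.holder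
  -- `L` dominates `d x₀ x + d x₀ y` whenever `d x y < 1`, so the Hölder bound depends on `s` alone.
  set L := d x₀ x + K * (d x₀ x + 1) + 1 with hL
  have h0 := hd.nonneg x₀ x
  have hLpos : 0 < L := by positivity
  have hc : Tendsto (fun s : ℝ => β * s ^ α * L ^ (1 - α)) (𝓝[>] 0) (𝓝 0) := by
    have h : ContinuousAt (fun s : ℝ => β * s ^ α * L ^ (1 - α)) 0 :=
      (continuousAt_const.mul (Real.continuousAt_rpow_const _ _ (Or.inr hα.le))).mul
        continuousAt_const
    have := h.tendsto
    simp only [Real.zero_rpow hα.ne', mul_zero, zero_mul] at this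
    exact this.mono_left nhdsWithin_le_nhds
  obtain ⟨s, hs1, hs2, hs0⟩ := ((hc.eventually_lt_const hτ).and
    ((eventually_nhdsWithin_of_eventually_nhds (eventually_lt_nhds zero_lt_one)).and
      self_mem_nhdsWithin)).exists
  refine ⟨s, hs0, fun y hy => lt_of_le_of_lt (hol x₀ x y) (lt_of_le_of_lt ?_ hs1)⟩
  have hy' : d x y < s := hy
  have h1 := hd.nonneg x y
  have h2 := hd.nonneg x₀ y
  have h3 : d x₀ y ≤ K * (d x₀ x + 1) :=
    (htri x₀ y x).trans (mul_le_mul_of_nonneg_left (by linarith) (by linarith))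
  gcongr
  linarith

theorem IsHolderQuasiDist.isQOpen_qball (hd : IsHolderQuasiDist d) (x₀ : Y) (r : ℝ) :
    IsQOpen d (qball d x₀ r) := by
  intro x hx
  obtain ⟨s, hs, h⟩ := hd.exists_abs_sub_lt x₀ x (sub_pos.2 (mem_qball.1 hx))
  refine ⟨s, hs, fun y hy => ?_⟩
  have := (abs_lt.1 (h y hy)).1
  rw [mem_qball]; linarith

theorem IsHolderQuasiDist.isQOpen_lt (hd : IsHolderQuasiDist d) (x₀ : Y) (r : ℝ) :
    IsQOpen d {y | r < d x₀ y} := by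
  intro x hx
  obtain ⟨s, hs, h⟩ := hd.exists_abs_sub_lt x₀ x (sub_pos.2 (mem_ofPred.1 hx))
  refine ⟨s, hs, fun y hy => ?_⟩
  have := (abs_lt.1 (h y hy)).2
  rw [mem_ofPred]; linarith

theorem IsQOpen.inter {U V : Set Y} (hU : IsQOpen d U) (hV : IsQOpen d V) :
    IsQOpen d (U ∩ V) := by
  rintro x ⟨hxU, hxV⟩
  obtain ⟨r, hr, hrU⟩ := hU x hxU
  obtain ⟨s, hs, hsV⟩ := hV x hxV
  exact ⟨min r s, lt_min hr hs, fun y hy =>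
    ⟨hrU (qball_subset_qball (min_le_left _ _) hy), hsV (qball_subset_qball (min_le_right _ _) hy)⟩⟩

theorem IsQOpen.iUnion {ι : Sort*} {U : ι → Set Y} (hU : ∀ i, IsQOpen d (U i)) :
    IsQOpen d (⋃ i, U i) := by
  intro x hx
  obtain ⟨i, hi⟩ := mem_iUnion.1 hx
  obtain ⟨r, hr, h⟩ := hU i x hi
  exact ⟨r, hr, h.trans (subset_iUnion U i)⟩

theorem IsQOpen.iInter_finite {ι : Type*} {U : ι → Set Y} (hU : ∀ i, IsQOpen d (U i))
    (s : Finset ι) : IsQOpen d (⋂ i ∈ s, U i) := by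
  classical
  induction s using Finset.induction_on with
  | empty => exact fun x _ => ⟨1, one_pos, by simp⟩
  | insert i s _ ih =>
    rw [Finset.set_biInter_insert]
    exact (hU i).inter ih

/-- Balls of geometrically decreasing radius centered in one of the balls of radius
`R / 2 * (1 + 2⁻ᵏ)` are contained in the preceding one. -/
theorem IsHolderQuasiDist.exists_qball_subset (hd : IsHolderQuasiDist d) :
    ∃ m : ℕ, ∀ (k : ℕ) (x₀ : Y) (R : ℝ), 0 < R →
      ∀ x ∈ qball d x₀ (R / 2 * (1 + 1 / 2 ^ (k + 1))), ∀ ρ ≤ R / 2 ^ (m * (k + 1)),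
        qball d x ρ ⊆ qball d x₀ (R / 2 * (1 + 1 / 2 ^ k)) := by
  obtain ⟨K, hK, htri⟩ := hd.quasi_triangle
  obtain ⟨β, α, hβ, hα, hα1, hol⟩ := hd.holder
  -- Consecutive radii differ by `R / 4 * 2⁻ᵏ`, while a move of size `R / 2 ^ (m * (k + 1))` changes
  -- `d x₀` by at most `3 * K * β * q ^ (k + 1) * R`; this `q` makes the second fit into the first.
  set q : ℝ := min (1 / 2) (1 / (12 * K * β)) with hq
  have hq0 : 0 < q := by positivity
  have hqlt : (1 / 2 : ℝ) ^ α < 1 := Real.rpow_lt_one (by norm_num) (by norm_num) hα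
  obtain ⟨m, hm⟩ := exists_pow_lt_of_lt_one hq0 hqlt
  refine ⟨m, fun k x₀ R hR x hx ρ hρ y hy => ?_⟩
  have hx1 : d x₀ x < R / 2 * (1 + 1 / 2 ^ (k + 1)) := hx
  have hy1 : d x y < R / 2 ^ (m * (k + 1)) := lt_of_lt_of_le hy hρ
  have h2k : (1 : ℝ) / 2 ^ (k + 1) ≤ 1 :=
    div_le_self zero_le_one (one_le_pow₀ one_le_two)
  have hxR : d x₀ x < R := hx1.trans_le (by nlinarith)
  have hyR : d x y < R := hy1.trans_le (div_le_self hR.le (one_le_pow₀ one_le_two))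
  have h0 := hd.nonneg x₀ x
  have h0' := hd.nonneg x y
  have h0'' := hd.nonneg x₀ y
  have hy2 : d x₀ y ≤ K * (R + R) :=
    (htri x₀ y x).trans (mul_le_mul_of_nonneg_left (by linarith) (by linarith))
  have hsum : d x₀ x + d x₀ y ≤ 3 * K * R := by nlinarith
  have h1 := (abs_le.1 (hol x₀ x y)).1
  have hpow : (R / 2 ^ (m * (k + 1))) ^ α ≤ R ^ α * q ^ (k + 1) := by
    rw [div_eq_mul_one_div, Real.mul_rpow hR.le (by positivity), pow_mul, ← one_div_pow,
      ← one_div_pow, ← Real.rpow_natCast (((1 : ℝ) / 2) ^ m), ← Real.rpow_mul (by positivity),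
      mul_comm _ α, Real.rpow_mul (by positivity), Real.rpow_natCast,
      ← Real.rpow_natCast (1 / 2) m, ← Real.rpow_mul (by positivity), mul_comm _ α,
      Real.rpow_mul (by positivity), Real.rpow_natCast]
    gcongr
  have hrest : (3 * K * R) ^ (1 - α) ≤ 3 * K * R ^ (1 - α) := by
    rw [Real.mul_rpow (by positivity) hR.le]
    gcongr
    calc (3 * K) ^ (1 - α) ≤ (3 * K) ^ (1 : ℝ) :=
          Real.rpow_le_rpow_of_exponent_le (by linarith) (by linarith)
      _ = 3 * K := Real.rpow_one _
  have hRR : R ^ α * R ^ (1 - α) = R := by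
    rw [← Real.rpow_add hR, add_sub_cancel, Real.rpow_one]
  have hqk : 12 * K * β * q ^ (k + 1) ≤ 1 / 2 ^ k := by
    have e1 : 12 * K * β * q ≤ 1 := by
      have := mul_le_mul_of_nonneg_left (min_le_right (1 / 2 : ℝ) (1 / (12 * K * β)))
        (show 0 ≤ 12 * K * β by positivity)
      rwa [mul_one_div_cancel (by positivity)] at this
    calc 12 * K * β * q ^ (k + 1) = (12 * K * β * q) * q ^ k := by ring
      _ ≤ 1 * (1 / 2) ^ k := by
        gcongr
        exact min_le_left _ _
      _ = 1 / 2 ^ k := by rw [one_mul, one_div_pow]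
  have key : β * d x y ^ α * (d x₀ x + d x₀ y) ^ (1 - α) ≤ R / 4 * (1 / 2 ^ k) := by
    have h1α : 0 ≤ 1 - α := by linarith
    calc β * d x y ^ α * (d x₀ x + d x₀ y) ^ (1 - α)
        ≤ β * (R / 2 ^ (m * (k + 1))) ^ α * (3 * K * R) ^ (1 - α) := by gcongr
      _ ≤ β * (R ^ α * q ^ (k + 1)) * (3 * K * R ^ (1 - α)) := by gcongr
      _ = 3 * K * β * q ^ (k + 1) * (R ^ α * R ^ (1 - α)) := by ring
      _ = R / 4 * (12 * K * β * q ^ (k + 1)) := by rw [hRR]; ring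
      _ ≤ R / 4 * (1 / 2 ^ k) := by gcongr
  have e2 : (1 : ℝ) / 2 ^ (k + 1) = 1 / 2 * (1 / 2 ^ k) := by rw [pow_succ]; ring
  rw [e2] at hx1
  rw [mem_qball]
  nlinarith

/-! ### Infima and superlevel sets of partial functions -/

namespace PartialFun

variable {u : PartialFun Y} {B : Set Y} {t : ℝ}

theorem le_infOn (hB : B.Nonempty) (hdom : B ⊆ u.dom)
    (h : ∀ (y : Y) (hy : y ∈ u.dom), y ∈ B → t ≤ u.toFun ⟨y, hy⟩) : t ≤ u.infOn B := by
  obtain ⟨x, hx⟩ := hB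
  refine le_csInf ⟨_, x, hdom hx, hx, rfl⟩ ?_
  rintro _ ⟨y, hy, hyB, rfl⟩
  exact h y hy hyB

theorem infOn_le (hu : ∀ x, 0 ≤ u.toFun x) {y : Y} (hy : y ∈ u.dom) (hyB : y ∈ B) :
    u.infOn B ≤ u.toFun ⟨y, hy⟩ := by
  refine csInf_le ⟨0, ?_⟩ ⟨y, hy, hyB, rfl⟩
  rintro _ ⟨z, hz, -, rfl⟩
  exact hu _

theorem exists_lt_of_infOn_lt (hB : B.Nonempty) (hdom : B ⊆ u.dom) (h : u.infOn B < t) :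
    ∃ (y : Y) (hy : y ∈ u.dom), y ∈ B ∧ u.toFun ⟨y, hy⟩ < t := by
  by_contra! hle
  exact absurd (le_infOn hB hdom hle) (not_le.2 h)

open Classical in
/-- The extension of a partial function by zero. -/
noncomputable def extend (u : PartialFun Y) (y : Y) : ℝ :=
  if h : y ∈ u.dom then u.toFun ⟨y, h⟩ else 0

theorem extend_of_mem {y : Y} (hy : y ∈ u.dom) : u.extend y = u.toFun ⟨y, hy⟩ := dif_pos hy

theorem inter_strictSuperlevel (hdom : B ⊆ u.dom) :
    B ∩ u.strictSuperlevel t = B ∩ {y | t < u.extend y} := by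
  ext y
  refine and_congr_right fun hy => ?_
  rw [mem_ofPred, extend_of_mem (hdom hy)]
  exact ⟨fun ⟨_, h⟩ => h, fun h => ⟨hdom hy, h⟩⟩

/-- `u.dom` need not be measurable: the superlevel set is only the trace on `u.dom` of a measurable
set, and intersecting with a measurable `B ⊆ u.dom` gives a measurable set of `Y`. -/
theorem measurableSet_inter_extend [MeasurableSpace Y] (hu : Measurable u.toFun)
    (hB : MeasurableSet B) (hdom : B ⊆ u.dom) (t : ℝ) :
    MeasurableSet (B ∩ {y | t < u.extend y}) := by
  obtain ⟨V, hV, hVt⟩ := hu (measurableSet_Ioi (a := t))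
  convert hB.inter hV using 1
  ext y
  refine and_congr_right fun hy => ?_
  have : (⟨y, hdom hy⟩ : u.dom) ∈ Subtype.val ⁻¹' V ↔ (⟨y, hdom hy⟩ : u.dom) ∈ u.toFun ⁻¹' Ioi t :=
    by rw [hVt]
  rw [mem_ofPred, extend_of_mem (hdom hy)]
  exact this.symm

end PartialFun

/-! ### Doubling measures: regularity, Vitali covering, density points -/

variable [MeasurableSpace Y] {μ : Measure Y} {C_D : ℝ}

theorem IsDoubling.measure_qball_pos (hC : IsDoubling d μ C_D) (x : Y) {r : ℝ} (hr : 0 < r) :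
    0 < μ (qball d x r) := by
  have := hC.ball_pos x (r / 2) (by positivity)
  rwa [mul_div_cancel₀ r two_ne_zero] at this

theorem IsDoubling.measure_qball_two_pow_mul_le (hC : IsDoubling d μ C_D) (x : Y) {r : ℝ}
    (hr : 0 < r) (n : ℕ) :
    μ (qball d x (2 ^ n * r)) ≤ ENNReal.ofReal C_D ^ n * μ (qball d x r) := by
  induction n with
  | zero => simp
  | succ n ih =>
    rw [pow_succ', mul_assoc, pow_succ', mul_assoc]
    exact (hC.doubling x _ (by positivity)).trans (mul_le_mul_right ih _)

/-- Every ball lies in some `2 ^ n`-fold enlargement of the given one. Hence either all balls of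
positive radius have infinite measure or none has. -/
theorem IsDoubling.measure_qball_ne_top (hC : IsDoubling d μ C_D) (hd : IsQuasiDist d) {x : Y}
    {r : ℝ} (hr : 0 < r) (hfin : μ (qball d x r) ≠ ∞) (y : Y) (s : ℝ) : μ (qball d y s) ≠ ∞ := by
  obtain ⟨K, hK, htri⟩ := hd.quasi_triangle
  obtain ⟨n, hn⟩ := pow_unbounded_of_one_lt (K * (d x y + |s|) / r) one_lt_two
  rw [div_lt_iff₀ hr] at hn
  refine ne_top_of_le_ne_top (b := ENNReal.ofReal C_D ^ n * μ (qball d x r))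
    (ENNReal.mul_ne_top (by simp) hfin)
    ((measure_mono fun z hz => ?_).trans (hC.measure_qball_two_pow_mul_le x hr n))
  have hz' : d y z < s := hz
  have := htri x z y
  have h2 : K * (d x y + d y z) ≤ K * (d x y + |s|) :=
    mul_le_mul_of_nonneg_left (by linarith [le_abs_self s]) (by linarith)
  rw [mem_qball]
  linarith

/-- Regularity of a finite measure on the σ-algebra generated by the balls. -/
theorem IsHolderQuasiDist.exists_isQOpen_superset (hd : IsHolderQuasiDist d)
    (hball : ∀ x r, MeasurableSet (qball d x r)) (m : Measure Y) [IsFiniteMeasure m] {A : Set Y}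
    (hA : MeasurableSet[MeasurableSpace.generateFrom {s | ∃ x r, s = qball d x r}] A)
    {e : ℝ≥0∞} (he : e ≠ 0) :
    ∃ C U : Set Y, C ⊆ A ∧ A ⊆ U ∧ IsQOpen d U ∧ IsQOpen d Cᶜ ∧ MeasurableSet U ∧
      MeasurableSet C ∧ m (U \ C) < e := by
  induction A, hA using MeasurableSpace.generateFrom_induction generalizing e with
  | hC t ht =>
    obtain ⟨x, r, rfl⟩ := ht
    -- A ball is open, and the closed balls of radii `v n` exhaust it from inside.
    obtain ⟨v, hvm, hvlt, hv⟩ := exists_seq_strictMono_tendsto r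
    have hmeas : ∀ s, MeasurableSet {y | d x y ≤ s} := fun s => by
      have : {y | d x y ≤ s} = ⋂ n : ℕ, qball d x (s + 1 / (n + 1)) := by
        ext y
        simp only [mem_ofPred_eq, mem_iInter, mem_qball]
        refine ⟨fun h n => lt_of_le_of_lt h (lt_add_of_pos_right _ Nat.one_div_pos_of_nat),
          fun h => le_of_forall_pos_lt_add fun ε hε => ?_⟩
        obtain ⟨n, hn⟩ := exists_nat_one_div_lt hε
        exact (h n).trans (by linarith)
      rw [this]
      exact MeasurableSet.iInter fun n => hball _ _
    have hlim : Tendsto (fun n => m (qball d x r \ {y | d x y ≤ v n})) atTop (𝓝 0) := by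
      have hemp : ⋂ n, qball d x r \ {y | d x y ≤ v n} = ∅ := by
        rw [eq_empty_iff_forall_notMem]
        intro y hy
        rw [mem_iInter] at hy
        obtain ⟨n, hn⟩ := (hv.eventually_const_lt (mem_qball.1 (hy 0).1)).exists
        exact (hy n).2 hn.le
      rw [← measure_empty (μ := m), ← hemp]
      refine tendsto_measure_iInter_atTop
        (fun n => ((hball x r).diff (hmeas _)).nullMeasurableSet) (fun i j hij y hy => ?_)
        ⟨0, measure_ne_top _ _⟩
      exact ⟨hy.1, fun h => hy.2 (le_trans h (hvm.monotone hij))⟩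
    obtain ⟨n, hn⟩ := (hlim.eventually_lt_const (pos_iff_ne_zero.2 he)).exists
    refine ⟨{y | d x y ≤ v n}, qball d x r, fun y hy => lt_of_le_of_lt hy (hvlt n), Subset.rfl,
      hd.isQOpen_qball x r, ?_, hball x r, hmeas _, hn⟩
    convert hd.isQOpen_lt x (v n) using 1
    ext y
    simp
  | empty =>
    exact ⟨∅, ∅, Subset.rfl, Subset.rfl, fun x hx => hx.elim, fun x _ => ⟨1, one_pos, by simp⟩,
      MeasurableSet.empty, MeasurableSet.empty, by simpa using pos_iff_ne_zero.2 he⟩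
  | compl t _ ih =>
    obtain ⟨C, U, hCt, htU, hU, hC, hUm, hCm, hlt⟩ := ih he
    refine ⟨Uᶜ, Cᶜ, compl_subset_compl.2 htU, compl_subset_compl.2 hCt, hC, by rwa [compl_compl],
      hCm.compl, hUm.compl, ?_⟩
    rwa [sdiff_eq, compl_compl, inter_comm, ← sdiff_eq]
  | iUnion t _ ih =>
    obtain ⟨e', he'0, he'⟩ := ENNReal.exists_pos_sum_of_countable' (ENNReal.half_pos he).ne' ℕ
    choose C U hCt htU hU hC hUm hCm hlt using fun n => ih n (he'0 n).ne'
    have h1 : m ((⋃ n, U n) \ ⋃ n, C n) < e / 2 := by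
      refine lt_of_le_of_lt ((measure_mono ?_).trans
        ((measure_iUnion_le fun n => U n \ C n).trans (ENNReal.tsum_le_tsum fun n => (hlt n).le)))
        he'
      rintro y ⟨hy, hy'⟩
      obtain ⟨n, hn⟩ := mem_iUnion.1 hy
      exact mem_iUnion.2 ⟨n, hn, fun h => hy' (mem_iUnion.2 ⟨n, h⟩)⟩
    -- An infinite union of closed sets need not be closed, so only finitely many `C n` are kept;
    -- the second `e / 2` pays for the tail.
    have hlim : Tendsto (fun N => m ((⋃ n, C n) \ ⋃ n ∈ Finset.range N, C n)) atTop (𝓝 0) := by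
      have hemp : ⋂ N, ((⋃ n, C n) \ ⋃ n ∈ Finset.range N, C n) = ∅ := by
        rw [eq_empty_iff_forall_notMem]
        intro y hy
        rw [mem_iInter] at hy
        obtain ⟨n, hn⟩ := mem_iUnion.1 (hy 0).1
        exact (hy (n + 1)).2 (mem_biUnion (by simp) hn)
      rw [← measure_empty (μ := m), ← hemp]
      refine tendsto_measure_iInter_atTop
        (fun n => ((MeasurableSet.iUnion hCm).diff
          (Finset.measurableSet_biUnion _ fun i _ => hCm i)).nullMeasurableSet)
        (fun i j hij => sdiff_subset_sdiff_right
          (biUnion_subset_biUnion_left fun a ha => ?_)) ⟨0, measure_ne_top _ _⟩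
      simp only [SetLike.mem_coe, Finset.mem_range] at ha ⊢
      omega
    obtain ⟨N, hN⟩ := (hlim.eventually_lt_const (ENNReal.half_pos he)).exists
    refine ⟨⋃ n ∈ Finset.range N, C n, ⋃ n, U n,
      iUnion₂_subset fun n _ => (hCt n).trans (subset_iUnion t n), iUnion_mono htU,
      IsQOpen.iUnion hU, ?_, MeasurableSet.iUnion hUm,
      Finset.measurableSet_biUnion _ fun i _ => hCm i, ?_⟩
    · simp only [compl_iUnion]
      exact IsQOpen.iInter_finite hC _
    · calc m ((⋃ n, U n) \ ⋃ n ∈ Finset.range N, C n)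
          ≤ m (((⋃ n, U n) \ ⋃ n, C n) ∪ ((⋃ n, C n) \ ⋃ n ∈ Finset.range N, C n)) :=
            measure_mono fun y hy => by
              by_cases h : y ∈ ⋃ n, C n
              · exact Or.inr ⟨h, hy.2⟩
              · exact Or.inl ⟨hy.1, h⟩
        _ ≤ _ := measure_union_le _ _
        _ < e / 2 + e / 2 := ENNReal.add_lt_add h1 hN
        _ = e := ENNReal.add_halves e

/-- A set whose points are centers of balls contained in `V` that `A` fills at most to the
proportion `ν < 1` is controlled by `V \ A`. -/
theorem IsDoubling.measure_le_of_forall_qball_subset (hC : IsDoubling d μ C_D)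
    (hd : IsQuasiDist d) (hball : ∀ x r, MeasurableSet (qball d x r)) {K : ℝ} (hK : 1 ≤ K)
    (htri : ∀ x y z, d x y ≤ K * (d x z + d z y)) {b : ℕ} (hb : 3 * K ≤ 2 ^ b)
    {ν : ℝ} (hν₀ : 0 < ν) {s V A : Set Y} (hA : MeasurableSet A)
    (hVfin : μ V ≠ ∞) (ρ : Y → ℝ) {R : ℝ} (hρ : ∀ x ∈ s, 0 < ρ x)
    (hρR : ∀ x ∈ s, ρ x ≤ R) (hsub : ∀ x ∈ s, qball d x (ρ x) ⊆ V)
    (hdens : ∀ x ∈ s, μ (A ∩ qball d x (ρ x)) ≤ ENNReal.ofReal ν * μ (qball d x (ρ x))) :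
    ENNReal.ofReal (1 - ν) * μ s ≤ ENNReal.ofReal C_D ^ b * μ (V \ A) := by
  obtain ⟨w, hws, hdisj, hcov⟩ := Vitali.exists_disjoint_subfamily_covering_enlargement
    (fun x => qball d x (ρ x)) s ρ 2 one_lt_two (fun x hx => (hρ x hx).le) R hρR
    (fun x hx => ⟨x, hd.mem_qball_self x (hρ x hx)⟩)
  -- Disjoint balls of positive measure inside a set of finite measure.
  have hwc : w.Countable := by
    have := Measure.countable_meas_pos_of_disjoint_of_meas_iUnion_ne_top μ
      (As := fun y : w => qball d (y : Y) (ρ y)) (fun y => hball _ _)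
      (fun y z hyz => hdisj y.2 z.2 (Subtype.coe_injective.ne hyz))
      (measure_ne_top_of_subset (iUnion_subset fun y => hsub y (hws y.2)) hVfin)
    rw [← countable_coe_iff, ← countable_univ_iff]
    exact this.mono fun y _ => hC.measure_qball_pos _ (hρ y (hws y.2))
  -- A selected ball meets the ball around `x`, and `ρ x ≤ 2 * ρ y`, so `d y x < K * (ρ y + 2 * ρ y)
  -- ≤ 2 ^ b * ρ y`.
  have hscov : s ⊆ ⋃ y ∈ w, qball d y (2 ^ b * ρ y) := by
    intro x hx
    obtain ⟨y, hy, ⟨z, hz1, hz2⟩, hle⟩ := hcov x hx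
    refine mem_biUnion hy ?_
    have h1 : d x z < ρ x := hz1
    have h2 : d y z < ρ y := hz2
    have h3 := htri y x z
    rw [hd.symm z x] at h3
    have h4 : K * (d y z + d x z) < K * (3 * ρ y) :=
      mul_lt_mul_of_pos_left (by linarith) (by linarith)
    have h5 := mul_le_mul_of_nonneg_right hb (hρ y (hws hy)).le
    rw [mem_qball]
    linarith
  have := hwc.to_subtype
  have hone : ∀ y ∈ w, ENNReal.ofReal (1 - ν) * μ (qball d y (ρ y)) ≤ μ (qball d y (ρ y) \ A) := by
    intro y hy
    have hfin : μ (qball d y (ρ y)) ≠ ∞ := measure_ne_top_of_subset (hsub y (hws hy)) hVfin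
    have h1 := hdens y (hws hy)
    have h2 := measure_inter_add_sdiff (μ := μ) (qball d y (ρ y)) hA
    rw [inter_comm] at h2
    rw [ENNReal.ofReal_sub _ hν₀.le, ENNReal.ofReal_one, ENNReal.sub_mul (fun _ _ => hfin), one_mul,
      tsub_le_iff_left]
    conv_lhs => rw [← h2]
    gcongr
  calc ENNReal.ofReal (1 - ν) * μ s
      ≤ ENNReal.ofReal (1 - ν) * ∑' y : w, μ (qball d (y : Y) (2 ^ b * ρ y)) := by
        gcongr
        exact (measure_mono hscov).trans (measure_biUnion_le μ hwc _)
    _ ≤ ENNReal.ofReal (1 - ν) *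
          ∑' y : w, ENNReal.ofReal C_D ^ b * μ (qball d (y : Y) (ρ y)) := by
        gcongr with y
        exact hC.measure_qball_two_pow_mul_le _ (hρ _ (hws y.2)) b
    _ = ENNReal.ofReal C_D ^ b * ∑' y : w, ENNReal.ofReal (1 - ν) * μ (qball d (y : Y) (ρ y)) := by
        rw [ENNReal.tsum_mul_left, ENNReal.tsum_mul_left]
        ring
    _ ≤ ENNReal.ofReal C_D ^ b * ∑' y : w, μ (qball d (y : Y) (ρ y) \ A) := by
        gcongr with y
        exact hone y y.2
    _ = ENNReal.ofReal C_D ^ b * μ (⋃ y ∈ w, qball d y (ρ y) \ A) := by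
        rw [measure_biUnion hwc (hdisj.mono fun y => sdiff_subset) fun y _ => (hball _ _).diff hA]
    _ ≤ ENNReal.ofReal C_D ^ b * μ (V \ A) := by
        gcongr
        exact iUnion₂_subset fun y hy => sdiff_subset_sdiff_left (hsub y (hws hy))

/-- Almost every point of a measurable subset `A` of a ball is the center of a dyadic ball in which
`A` has proportion at least `ν < 1`. -/
theorem IsDoubling.ae_exists_density (hC : IsDoubling d μ C_D) (hd : IsHolderQuasiDist d)
    (hμ : IsRegularMeasure d μ) (hfin : ∀ x r, μ (qball d x r) ≠ ∞) {ν : ℝ} (hν₀ : 0 < ν)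
    (hν₁ : ν < 1) {A : Set Y} (hA : MeasurableSet A) {x₀ : Y} {R₀ R : ℝ} (hR : 0 < R)
    (hAR : A ⊆ qball d x₀ R₀) :
    ∀ᵐ x ∂μ, x ∈ A → ∃ j : ℕ, ENNReal.ofReal ν * μ (qball d x (R / 2 ^ j)) ≤
      μ (A ∩ qball d x (R / 2 ^ j)) := by
  obtain ⟨K, hK, htri⟩ := hd.quasi_triangle
  obtain ⟨b, hb⟩ := pow_unbounded_of_one_lt (3 * K) one_lt_two
  have hball := hμ.measurableSet_ball
  obtain ⟨B, hB, hAB⟩ := hμ.exists_ae_eq A hA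
  have hgen : MeasurableSpace.generateFrom {s | ∃ x r, s = qball d x r} ≤ ‹MeasurableSpace Y› :=
    MeasurableSpace.generateFrom_le (by rintro _ ⟨x, r, rfl⟩; exact hball x r)
  have hAB' : ∀ T, μ (A ∩ T) = μ (B ∩ T) := fun T => measure_congr (hAB.inter (ae_eq_refl T))
  -- The bad points are taken in `B` because regularity is available only on the σ-algebra generated
  -- by the balls.
  set N := {x | x ∈ A ∩ B ∧ ∀ j : ℕ, μ (A ∩ qball d x (R / 2 ^ j)) <
    ENNReal.ofReal ν * μ (qball d x (R / 2 ^ j))} with hN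
  have hN0 : μ N = 0 := by
    set m := μ.restrict (qball d x₀ R₀) with hm
    have : IsFiniteMeasure m := ⟨by simpa [hm] using (hfin x₀ R₀).lt_top⟩
    -- Around bad points, small dyadic balls fit into an open `U ⊇ B` and are filled by `B` at most
    -- to proportion `ν`, so the covering estimate bounds `μ N` by a multiple of the arbitrarily
    -- small excess of `U` over `B`.
    have key : ∀ e : ℝ≥0∞, e ≠ 0 →
        ENNReal.ofReal (1 - ν) * μ N ≤ ENNReal.ofReal C_D ^ b * e := by
      intro e he
      obtain ⟨C, U, hCB, hBU, hUo, -, -, -, hlt⟩ := hd.exists_isQOpen_superset hball m hB he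
      have hVo := hUo.inter (hd.isQOpen_qball x₀ R₀)
      have hex : ∀ x ∈ N, ∃ j : ℕ, qball d x (R / 2 ^ j) ⊆ U ∩ qball d x₀ R₀ := by
        intro x hx
        obtain ⟨r, hr, hrU⟩ := hVo x ⟨hBU hx.1.2, hAR hx.1.1⟩
        obtain ⟨j, hj⟩ := pow_unbounded_of_one_lt (R / r) one_lt_two
        refine ⟨j, (qball_subset_qball ?_).trans hrU⟩
        rw [div_lt_iff₀ hr] at hj
        rw [div_le_iff₀ (by positivity)]
        linarith
      choose! j hj using hex
      refine (hC.measure_le_of_forall_qball_subset hd.toIsQuasiDist hball hK htri hb.le hν₀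
        (hgen _ hB) (measure_ne_top_of_subset inter_subset_right
          (hfin x₀ R₀)) (fun x => R / 2 ^ j x) (R := R) (fun x _ => by positivity)
        (fun x _ => div_le_self hR.le (one_le_pow₀ one_le_two)) hj
        (fun x hx => (hAB' _).symm.trans_le (hx.2 _).le)).trans ?_
      gcongr
      refine le_trans ?_ hlt.le
      rw [hm, Measure.restrict_apply' (hball _ _)]
      exact measure_mono fun y hy => ⟨⟨hy.1.1, fun h => hy.2 (hCB h)⟩, hy.1.2⟩
    have hlim : Tendsto (fun e : ℝ≥0∞ => ENNReal.ofReal C_D ^ b * e) (𝓝[≠] 0) (𝓝 0) := by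
      have := (ENNReal.Tendsto.const_mul (a := ENNReal.ofReal C_D ^ b) (tendsto_id (x := 𝓝 0))
        (Or.inr (by simp)))
      rw [mul_zero] at this
      exact this.mono_left nhdsWithin_le_nhds
    have h0 : ENNReal.ofReal (1 - ν) * μ N ≤ 0 :=
      ge_of_tendsto hlim (eventually_nhdsWithin_of_forall key)
    rw [nonpos_iff_eq_zero, mul_eq_zero, ENNReal.ofReal_eq_zero] at h0
    exact h0.resolve_left (by linarith)
  have hN' : ∀ᵐ x ∂μ, x ∉ N := measure_eq_zero_iff_ae_notMem.1 hN0
  filter_upwards [hN', hAB.mem_iff] with x hx hxAB hxA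
  by_contra! h
  exact hx ⟨⟨hxA, hxAB.1 hxA⟩, h⟩

/-! ### Decay of level sets from critical density and doubling -/

/-- The scaled critical density and double ball properties of a function `U` on the balls `B` with
`η B ⊆ D`, for levels `t ≥ 1`. -/
structure HasGrowthOn (d : Y → Y → ℝ) (μ : Measure Y) (U : Y → ℝ) (D : Set Y) (ν c γ η : ℝ) :
    Prop where
  criticalDensity : ∀ x r t, 0 < r → 1 ≤ t → qball d x (η * r) ⊆ D →
    ENNReal.ofReal ν * μ (qball d x r) ≤ μ (qball d x r ∩ {y | t ≤ U y}) →
      ∀ y ∈ qball d x (r / 2), c * t ≤ U y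
  doubleBall : ∀ x r t, 0 < r → 1 ≤ t → qball d x (η * r) ⊆ D →
    (∀ y ∈ qball d x (r / 2), t ≤ U y) → ∀ y ∈ qball d x r, γ * t ≤ U y

namespace HasGrowthOn

variable {U : Y → ℝ} {D : Set Y} {ν c γ η : ℝ}

/-- Doubling applies only at levels at least `1`; since levels decrease along the iteration, it
suffices to require this of the last one. -/
theorem doubleBall_iterate (h : HasGrowthOn d μ U D ν c γ η) (hγ₀ : 0 < γ) (hγ₁ : γ < 1)
    (hη : 1 < η) {x : Y} {ρ t : ℝ} (hρ : 0 < ρ) (i : ℕ) (ht : 1 ≤ γ ^ i * t)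
    (hD : qball d x (η * (2 ^ i * ρ)) ⊆ D) (hU : ∀ y ∈ qball d x ρ, t ≤ U y) :
    ∀ y ∈ qball d x (2 ^ i * ρ), γ ^ i * t ≤ U y := by
  induction i with
  | zero => simpa using hU
  | succ i ih =>
    have ht0 : 0 < t := by
      by_contra! h0
      linarith [mul_nonpos_of_nonneg_of_nonpos (pow_pos hγ₀ (i + 1)).le h0]
    have h1 : 1 ≤ γ ^ i * t := ht.trans (mul_le_mul_of_nonneg_right
      (pow_le_pow_of_le_one hγ₀.le hγ₁.le i.le_succ) ht0.le)
    have h2 : (2 : ℝ) ^ (i + 1) * ρ / 2 = 2 ^ i * ρ := by rw [pow_succ]; ring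
    have h3 : (2 : ℝ) ^ i * ρ ≤ 2 ^ (i + 1) * ρ := by
      have : (0 : ℝ) < 2 ^ i * ρ := by positivity
      rw [pow_succ]; linarith
    have := h.doubleBall x (2 ^ (i + 1) * ρ) (γ ^ i * t) (by positivity) h1 hD (by
      rw [h2]
      exact ih h1 ((qball_subset_qball (mul_le_mul_of_nonneg_left h3 (by linarith))).trans hD))
    rwa [← mul_assoc, ← pow_succ'] at this

/-- Critical density in a ball of radius `R / 2 ^ j` is incompatible with a small infimum over a
ball of radius `R` if the level is large in terms of `j`. -/
theorem level_le_one (h : HasGrowthOn d μ U D ν c γ η) (hd : IsQuasiDist d) (hγ₀ : 0 < γ)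
    (hγ₁ : γ < 1) (hη : 1 < η) {K : ℝ} (hK : 1 ≤ K)
    (htri : ∀ x y z, d x y ≤ K * (d x z + d z y)) {a : ℕ} (ha : 2 * K ≤ 2 ^ a) {x₀ x : Y} {R : ℝ}
    (hR : 0 < R) (hx : x ∈ qball d x₀ R) (hD : qball d x (η * (2 ^ a * R)) ⊆ D)
    (hinf : ∀ t, 1 < t → ∃ y ∈ qball d x₀ R, U y < t) {t : ℝ} (ht : 1 ≤ t) {j : ℕ}
    (hdens : ENNReal.ofReal ν * μ (qball d x (R / 2 ^ j)) ≤
      μ (qball d x (R / 2 ^ j) ∩ {y | t ≤ U y})) :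
    γ ^ (j + a + 1) * (c * t) ≤ 1 := by
  by_contra! hlt
  have hrad : R / 2 ^ j ≤ 2 ^ a * R :=
    (div_le_self hR.le (one_le_pow₀ one_le_two)).trans
      (le_mul_of_one_le_left hR.le (one_le_pow₀ one_le_two))
  -- One doubling undoes the half ball of critical density, `j` reach radius `R`, and `a` more make
  -- the ball around `x` contain `B_R(x₀)`.
  have hrad' : (2 : ℝ) ^ (j + a + 1) * (R / 2 ^ j / 2) = 2 ^ a * R := by
    rw [pow_succ, pow_add]
    field_simp
  have h1 := h.criticalDensity x (R / 2 ^ j) t (by positivity) ht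
    ((qball_subset_qball (mul_le_mul_of_nonneg_left hrad (by linarith))).trans hD) hdens
  have h2 := h.doubleBall_iterate hγ₀ hγ₁ hη (by positivity) (j + a + 1) hlt.le
    (by rwa [hrad']) h1
  rw [hrad'] at h2
  obtain ⟨y, hy, hyt⟩ := hinf _ hlt
  refine absurd (h2 y ?_) (not_le.2 hyt)
  have h3 := htri x y x₀
  rw [hd.symm x x₀] at h3
  have hx' : d x₀ x < R := hx
  have hy' : d x₀ y < R := hy
  have h4 : K * (d x₀ x + d x₀ y) < K * (R + R) :=
    mul_lt_mul_of_pos_left (by linarith) (by linarith)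
  have h5 := mul_le_mul_of_nonneg_right ha hR.le
  rw [mem_qball]
  linarith

/-- The decay of the measure from one level set to the next. -/
theorem measure_level_succ_le (hC : IsDoubling d μ C_D) (hd : IsHolderQuasiDist d)
    (hμ : IsRegularMeasure d μ) (hfin : ∀ x r, μ (qball d x r) ≠ ∞) (hν₀ : 0 < ν) (hν₁ : ν < 1)
    (hc₀ : 0 < c) (hc₁ : c < 1) (hγ₀ : 0 < γ) (hγ₁ : γ < 1) (hη : 1 < η) {K : ℝ} (hK : 1 ≤ K)
    (htri : ∀ x y z, d x y ≤ K * (d x z + d z y)) {a : ℕ} (ha : 2 * K ≤ 2 ^ a) {b : ℕ}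
    (hb : 3 * K ≤ 2 ^ b) {m : ℕ}
    (hm : ∀ (k : ℕ) (x₀ : Y) (R : ℝ), 0 < R →
      ∀ x ∈ qball d x₀ (R / 2 * (1 + 1 / 2 ^ (k + 1))), ∀ ρ ≤ R / 2 ^ (m * (k + 1)),
        qball d x ρ ⊆ qball d x₀ (R / 2 * (1 + 1 / 2 ^ k)))
    {M : ℝ} (hM : γ ^ (m + a + 1) * (c * M) = 2) {x₀ : Y} {R : ℝ} (hR : 0 < R)
    (h : HasGrowthOn d μ U D ν c γ η)
    (hD : ∀ x ∈ qball d x₀ R, qball d x (η * (2 ^ a * R)) ⊆ D)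
    (hmeas : ∀ t, MeasurableSet (qball d x₀ R ∩ {y | t < U y}))
    (hinf : ∀ t, 1 < t → ∃ y ∈ qball d x₀ R, U y < t) (k : ℕ) :
    ENNReal.ofReal (1 - ν) *
        μ (qball d x₀ (R / 2 * (1 + 1 / 2 ^ (k + 1))) ∩ {y | M ^ (k + 1) < U y}) ≤
      ENNReal.ofReal C_D ^ b *
        μ ((qball d x₀ (R / 2 * (1 + 1 / 2 ^ k)) ∩ {y | M ^ k < U y}) \
          (qball d x₀ (R / 2 * (1 + 1 / 2 ^ (k + 1))) ∩ {y | M ^ (k + 1) < U y})) := by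
  have hRk : ∀ n : ℕ, R / 2 * (1 + 1 / 2 ^ n) ≤ R := fun n => by
    have : (1 : ℝ) / 2 ^ n ≤ 1 := div_le_self zero_le_one (one_le_pow₀ one_le_two)
    nlinarith
  have hE : ∀ (n : ℕ) (t : ℝ),
      MeasurableSet (qball d x₀ (R / 2 * (1 + 1 / 2 ^ n)) ∩ {y | t < U y}) := fun n t => by
    have := (hμ.measurableSet_ball x₀ (R / 2 * (1 + 1 / 2 ^ n))).inter (hmeas t)
    rwa [← inter_assoc, inter_eq_left.2 (qball_subset_qball (hRk n))] at this
  -- Ensures `2 ≤ m + a + 1`, so that `hMγ` covers the two doublings used below.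
  have ha1 : 1 ≤ a := by
    by_contra! h0
    obtain rfl : a = 0 := by omega
    norm_num at ha
    linarith
  have hM0 : 0 < M := by
    by_contra! h0
    have := mul_nonpos_of_nonneg_of_nonpos (pow_pos hγ₀ (m + a + 1)).le
      (mul_nonpos_of_nonneg_of_nonpos hc₀.le h0)
    linarith
  have hMγ : ∀ i ≤ m + a + 1, 1 < γ ^ i * (c * M) := fun i hi => by
    have h1 : γ ^ (m + a + 1) * (c * M) ≤ γ ^ i * (c * M) := by
      gcongr 1
      exact pow_le_pow_of_le_one hγ₀.le hγ₁.le hi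
    linarith
  have hM1 : 1 < M := by
    have h1 := hMγ 0 (Nat.zero_le _)
    rw [pow_zero, one_mul] at h1
    nlinarith
  set A := qball d x₀ (R / 2 * (1 + 1 / 2 ^ (k + 1))) ∩ {y | M ^ (k + 1) < U y} with hA
  set V := qball d x₀ (R / 2 * (1 + 1 / 2 ^ k)) ∩ {y | M ^ k < U y} with hV
  have ht1 : 1 ≤ M ^ (k + 1) := one_le_pow₀ hM1.le
  have hAR : A ⊆ qball d x₀ R := inter_subset_left.trans (qball_subset_qball (hRk _))
  have hdens' : ∀ x j, ENNReal.ofReal ν * μ (qball d x (R / 2 ^ j)) ≤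
      μ (A ∩ qball d x (R / 2 ^ j)) → ENNReal.ofReal ν * μ (qball d x (R / 2 ^ j)) ≤
        μ (qball d x (R / 2 ^ j) ∩ {y | M ^ (k + 1) ≤ U y}) := fun x j hx =>
    hx.trans (measure_mono fun y hy => ⟨hy.2, (mem_ofPred.1 hy.1.2).le⟩)
  set s := {x | x ∈ A ∧ ∃ j : ℕ, ENNReal.ofReal ν * μ (qball d x (R / 2 ^ j)) ≤
    μ (A ∩ qball d x (R / 2 ^ j))} with hs
  have hAs : μ A = μ s := by
    refine le_antisymm (measure_mono_ae ?_) (measure_mono fun x hx => hx.1)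
    filter_upwards [hC.ae_exists_density hd hμ hfin hν₀ hν₁ (hE _ _) hR hAR] with x hx hxA
    exact ⟨hxA, hx hxA⟩
  have hex : ∀ x ∈ s, ∃ j : ℕ, qball d x (R / 2 ^ j) ⊆ V ∧
      μ (A ∩ qball d x (R / 2 ^ j)) ≤ ENNReal.ofReal ν * μ (qball d x (R / 2 ^ j)) := by
    classical
    rintro x ⟨hxA, hxj⟩
    -- Stopping argument: the least `j` is the largest dense dyadic ball, so the next larger one is
    -- not dense.
    set j := Nat.find hxj with hj
    have hjspec := hdens' x j (Nat.find_spec hxj)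
    have hlev := h.level_le_one hd.toIsQuasiDist hγ₀ hγ₁ hη hK htri ha hR (hAR hxA)
      (hD x (hAR hxA)) hinf ht1 hjspec
    -- If `j ≤ m * (k + 1)`, then `j + a + 1 ≤ (m + a + 1) * (k + 1)`, and by `hM` the quantity
    -- bounded by `1` in `hlev` would be at least `2 ^ (k + 1)`.
    have hjm : m * (k + 1) < j := by
      by_contra! hle
      have h1 : (γ ^ (m + a + 1) * (c * M)) ^ (k + 1) ≤ γ ^ (j + a + 1) * (c * M ^ (k + 1)) := by
        rw [mul_pow, mul_pow, ← pow_mul]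
        have e1 : γ ^ ((m + a + 1) * (k + 1)) ≤ γ ^ (j + a + 1) :=
          pow_le_pow_of_le_one hγ₀.le hγ₁.le (by nlinarith)
        have e2 : c ^ (k + 1) ≤ c := pow_le_of_le_one hc₀.le hc₁.le k.succ_ne_zero
        gcongr
      rw [hM] at h1
      have : (1 : ℝ) < 2 ^ (k + 1) := one_lt_pow₀ one_lt_two k.succ_ne_zero
      linarith
    obtain ⟨i, hi⟩ : ∃ i, j = i + 1 := ⟨j - 1, by omega⟩
    have hnot := Nat.find_min hxj (m := i) (by omega)
    refine ⟨i, fun y hy => ⟨?_, ?_⟩, (not_le.1 hnot).le⟩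
    · refine hm k x₀ R hR x hxA.1 (R / 2 ^ i) ?_ hy
      exact div_le_div_of_nonneg_left hR.le (by positivity)
        (pow_le_pow_right₀ one_le_two (by omega))
    -- Critical density reaches radius `R / 2 ^ (i + 2)`; two doublings reach `R / 2 ^ i`, and the
    -- loss `γ ^ 2 * c` is less than the factor `M` gained between levels.
    · rw [hi] at hjspec
      have h2a : (1 : ℝ) ≤ 2 ^ a := one_le_pow₀ one_le_two
      have hi1 : R / 2 ^ i ≤ 2 ^ a * R :=
        (div_le_self hR.le (one_le_pow₀ one_le_two)).trans (le_mul_of_one_le_left hR.le h2a)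
      have hi2 : R / 2 ^ (i + 1) ≤ R / 2 ^ i :=
        div_le_div_of_nonneg_left hR.le (by positivity) (pow_le_pow_right₀ one_le_two i.le_succ)
      have hDi : qball d x (η * (R / 2 ^ i)) ⊆ D :=
        (qball_subset_qball (mul_le_mul_of_nonneg_left hi1 (by linarith))).trans
          (hD x (hAR hxA))
      have h1 := h.criticalDensity x _ _ (by positivity) ht1
        ((qball_subset_qball (mul_le_mul_of_nonneg_left hi2 (by linarith))).trans hDi) hjspec
      have hγ2 := hMγ 2 (by omega)
      have hMk : (0 : ℝ) < M ^ k := by positivity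
      have hlt : M ^ k < γ ^ 2 * (c * M ^ (k + 1)) := by
        calc M ^ k = M ^ k * 1 := (mul_one _).symm
          _ < M ^ k * (γ ^ 2 * (c * M)) := by gcongr
          _ = γ ^ 2 * (c * M ^ (k + 1)) := by ring
      have hrad : (2 : ℝ) ^ 2 * (R / 2 ^ (i + 1) / 2) = R / 2 ^ i := by
        rw [pow_succ (2 : ℝ) i]
        field_simp
      have h2 := h.doubleBall_iterate hγ₀ hγ₁ hη (by positivity) 2
        ((one_le_pow₀ hM1.le).trans hlt.le) (by rwa [hrad]) h1
      rw [hrad] at h2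
      exact hlt.trans_le (h2 y hy)
  choose! j hjV hjd using hex
  rw [hAs]
  exact hC.measure_le_of_forall_qball_subset hd.toIsQuasiDist hμ.measurableSet_ball hK htri hb hν₀
    (hE _ _) (measure_ne_top_of_subset inter_subset_left (hfin _ _)) (fun x => R / 2 ^ j x) (R := R)
    (fun x _ => by positivity) (fun x _ => div_le_self hR.le (one_le_pow₀ one_le_two)) hjV hjd

end HasGrowthOn

/-- Power decay for functions with scaled critical density and double ball properties. -/
theorem exists_measure_superlevel_le (hC : IsDoubling d μ C_D) (hd : IsHolderQuasiDist d)
    (hμ : IsRegularMeasure d μ) (hfin : ∀ x r, μ (qball d x r) ≠ ∞) {ν c γ η : ℝ} (hν₀ : 0 < ν)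
    (hν₁ : ν < 1) (hc₀ : 0 < c) (hc₁ : c < 1) (hγ₀ : 0 < γ) (hγ₁ : γ < 1) (hη : 1 < η) :
    ∃ M P : ℝ, 1 < M ∧ 1 < P ∧ ∀ (x₀ : Y) (R : ℝ) (U : Y → ℝ), 0 < R →
      HasGrowthOn d μ U (qball d x₀ (P * R)) ν c γ η →
      (∀ t, MeasurableSet (qball d x₀ R ∩ {y | t < U y})) →
      (∀ t, 1 < t → ∃ y ∈ qball d x₀ R, U y < t) → ∀ k : ℕ,
        μ (qball d x₀ (R / 2) ∩ {y | M ^ k < U y}) ≤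
          ENNReal.ofReal ((1 / 2) ^ k) * μ (qball d x₀ (R / 2)) := by
  obtain ⟨K, hK, htri⟩ := hd.quasi_triangle
  obtain ⟨m, hm⟩ := hd.exists_qball_subset
  obtain ⟨a, ha⟩ := pow_unbounded_of_one_lt (2 * K) one_lt_two
  obtain ⟨b, hb⟩ := pow_unbounded_of_one_lt (3 * K) one_lt_two
  set M : ℝ := 2 / (γ ^ (m + a + 1) * c) with hMdef
  have hM : γ ^ (m + a + 1) * (c * M) = 2 := by
    rw [hMdef]
    field_simp
  have hM1 : 1 < M := by
    rw [hMdef, one_lt_div (by positivity)]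
    have : γ ^ (m + a + 1) * c ≤ 1 * 1 := by
      gcongr
      exact pow_le_one₀ hγ₀.le hγ₁.le
    linarith
  have hCpos := hC.const_pos
  -- Obtained by moving `C_D ^ b * μ (E (k + 1))` to the left in the level estimate.
  set θ : ℝ := C_D ^ b / (1 - ν + C_D ^ b) with hθ
  have hden : 0 < 1 - ν + C_D ^ b := by
    have : 0 < 1 - ν := by linarith
    positivity
  have hθ0 : 0 < θ := by positivity
  have hθ1 : θ < 1 := by
    rw [hθ, div_lt_one hden]
    linarith
  -- Keeping every `n`-th level only, with `(C_D + 1) * θ ^ n < 1 / 2`, absorbs the factor `C_D`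
  -- lost in comparing `E 0` with the half ball.
  obtain ⟨n, hn⟩ := exists_pow_lt_of_lt_one (show 0 < 1 / (2 * (C_D + 1)) by positivity) hθ1
  have hn0 : n ≠ 0 := by
    rintro rfl
    rw [pow_zero, lt_div_iff₀ (by positivity)] at hn
    linarith
  refine ⟨M ^ n, K * (1 + η * 2 ^ a) + 1, one_lt_pow₀ hM1 hn0, by
    have : 0 < K * (1 + η * 2 ^ a) := by positivity
    linarith, fun x₀ R U hR hU hmeas hinf => ?_⟩
  set E : ℕ → Set Y := fun k => qball d x₀ (R / 2 * (1 + 1 / 2 ^ k)) ∩ {y | M ^ k < U y} with hE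
  have hD : ∀ x ∈ qball d x₀ R,
      qball d x (η * (2 ^ a * R)) ⊆ qball d x₀ ((K * (1 + η * 2 ^ a) + 1) * R) := by
    intro x hx y hy
    have hx' : d x₀ x < R := hx
    have hy' : d x y < η * (2 ^ a * R) := hy
    have h1 := htri x₀ y x
    have h2 : K * (d x₀ x + d x y) < K * (R + η * (2 ^ a * R)) :=
      mul_lt_mul_of_pos_left (by linarith) (by linarith)
    rw [mem_qball]
    nlinarith
  have hstep : ∀ k, μ (E (k + 1)) ≤ ENNReal.ofReal θ * μ (E k) := by
    intro k
    have h1 := hU.measure_level_succ_le hC hd hμ hfin hν₀ hν₁ hc₀ hc₁ hγ₀ hγ₁ hη hK htri ha.le hb.le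
      hm hM hR hD hmeas hinf k
    have hsub : E (k + 1) ⊆ E k := fun y hy =>
      ⟨qball_subset_qball (by gcongr <;> norm_num) hy.1,
        lt_of_le_of_lt (pow_le_pow_right₀ hM1.le k.le_succ) hy.2⟩
    have hEm : MeasurableSet (E (k + 1)) := by
      have := (hμ.measurableSet_ball x₀ (R / 2 * (1 + 1 / 2 ^ (k + 1)))).inter
        (hmeas (M ^ (k + 1)))
      rwa [← inter_assoc, inter_eq_left.2 (qball_subset_qball ?_)] at this
      have : (1 : ℝ) / 2 ^ (k + 1) ≤ 1 := div_le_self zero_le_one (one_le_pow₀ one_le_two)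
      nlinarith
    have h2 : ENNReal.ofReal (1 - ν + C_D ^ b) * μ (E (k + 1)) ≤
        ENNReal.ofReal (C_D ^ b) * μ (E k) := by
      rw [← measure_inter_add_sdiff (μ := μ) (E k) hEm, inter_eq_right.2 hsub,
        ENNReal.ofReal_add (by linarith) (by positivity), add_mul, mul_add]
      refine (add_comm _ _).trans_le (add_le_add le_rfl ?_)
      rw [ENNReal.ofReal_pow hCpos.le]
      exact h1
    rw [hθ, ENNReal.ofReal_div_of_pos hden, div_eq_mul_inv, mul_right_comm, ← div_eq_mul_inv,
      ENNReal.le_div_iff_mul_le (Or.inl (by simpa using hden)) (Or.inl ENNReal.ofReal_ne_top),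
      mul_comm]
    exact h2
  have hall : ∀ k, μ (E k) ≤ ENNReal.ofReal (C_D * θ ^ k) * μ (qball d x₀ (R / 2)) := by
    intro k
    induction k with
    | zero =>
      have h1 := hC.doubling x₀ (R / 2) (by positivity)
      rw [pow_zero, mul_one]
      refine (measure_mono ?_).trans h1
      refine inter_subset_left.trans (qball_subset_qball ?_)
      norm_num
      linarith
    | succ k ih =>
      refine (hstep k).trans ?_
      calc ENNReal.ofReal θ * μ (E k)
          ≤ ENNReal.ofReal θ * (ENNReal.ofReal (C_D * θ ^ k) * μ (qball d x₀ (R / 2))) := by gcongr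
        _ = ENNReal.ofReal (C_D * θ ^ (k + 1)) * μ (qball d x₀ (R / 2)) := by
          rw [← mul_assoc, ← ENNReal.ofReal_mul hθ0.le]
          congr 2
          ring
  intro k
  rcases Nat.eq_zero_or_pos k with rfl | hk
  · simpa using measure_mono inter_subset_left
  rw [← pow_mul]
  have hsub : qball d x₀ (R / 2) ∩ {y | M ^ (n * k) < U y} ⊆ E (n * k) :=
    inter_subset_inter_left _ (qball_subset_qball
      (le_mul_of_one_le_right (by positivity) (le_add_of_nonneg_right (by positivity))))
  refine (measure_mono hsub).trans ((hall _).trans ?_)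
  gcongr
  calc C_D * θ ^ (n * k) ≤ (C_D + 1) ^ k * (θ ^ n) ^ k := by
        rw [pow_mul]
        gcongr
        exact (by linarith : C_D ≤ C_D + 1).trans (le_self_pow₀ (by linarith) hk.ne')
    _ = ((C_D + 1) * θ ^ n) ^ k := by rw [mul_pow]
    _ ≤ (1 / 2) ^ k := by
        gcongr
        rw [lt_div_iff₀ (by positivity)] at hn
        linarith

/-! ### Application to the families `K` -/

variable {Ω : Set Y} {S : Set Y → (Ω → ℝ) → ℝ≥0∞}
  {K : (Ω → ℝ) → Set (PartialFun Y)}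

/-- The critical density property with `ν < 1 / C_D ^ 2` implies the double ball property. -/
theorem HasCriticalDensity.hasDoubleBall (hC : IsDoubling d μ C_D)
    (hK : IsAdmissibleFamily d Ω S K) {ν : ℝ} (hν : ν < 1 / C_D ^ 2)
    (h : HasCriticalDensity d μ Ω S K ν) : HasDoubleBall d Ω S K := by
  obtain ⟨c, ε, η, hc₀, hc₁, hε₀, hε₁, hη, h⟩ := h
  refine ⟨c, ε, 2 * η, hc₀, hc₁, hε₀, hε₁, by linarith, fun f hf x₀ R hR hΩ u hu hdom hinf hS => ?_⟩
  have hCpos := hC.const_pos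
  have e1 : 2 * η * R = η * (2 * R) := by ring
  have e2 : 2 * R / 2 = R := by ring
  rw [e1] at hΩ hdom hS
  have := h f hf x₀ (2 * R) (by positivity) hΩ u hu hdom
  rw [e2] at this
  refine (this ?_).resolve_right (not_le.2 hS)
  have hRη : R / 2 ≤ η * (2 * R) := by nlinarith
  -- The ball of radius `R / 2`, where `u ≥ 1`, already fills a proportion `1 / C_D ^ 2 > ν` of the
  -- ball of radius `2 * R`.
  calc ENNReal.ofReal ν * μ (qball d x₀ (2 * R))
      ≤ ENNReal.ofReal (1 / C_D ^ 2) * (ENNReal.ofReal C_D ^ 2 * μ (qball d x₀ (R / 2))) := by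
        gcongr
        have h2 := hC.measure_qball_two_pow_mul_le x₀ (half_pos hR) 2
        rwa [show (2 : ℝ) ^ 2 * (R / 2) = 2 * R by ring] at h2
    _ = μ (qball d x₀ (R / 2)) := by
        rw [← mul_assoc, ← ENNReal.ofReal_pow hCpos.le, ← ENNReal.ofReal_mul (by positivity),
          one_div_mul_cancel (by positivity), ENNReal.ofReal_one, one_mul]
    _ ≤ μ (qball d x₀ (2 * R) ∩ u.superlevel 1) := by
        refine measure_mono fun y hy => ⟨qball_subset_qball (by linarith) hy,
          hdom (qball_subset_qball hRη hy), ?_⟩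
        exact hinf.trans (PartialFun.infOn_le (hK.nonneg f hf u hu) _ hy)

/-- A member of the family inherits the scaled critical density and double ball properties on balls
where the size functional is small. -/
theorem hasGrowthOn_extend (hd : IsQuasiDist d) (hS : IsSizeFunctional d Ω S)
    (hK : IsAdmissibleFamily d Ω S K) {ν c γ ε₁ ε₂ η₁ η₂ : ℝ} (hη₁ : 1 < η₁) (hη₂ : 1 < η₂)
    (hCD : ∀ f ∈ classL d Ω S, CriticalDensity d μ Ω S K f ν c ε₁ η₁)
    (hDB : ∀ f ∈ classL d Ω S, DoubleBall d Ω S K f γ ε₂ η₂)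
    {f : Ω → ℝ} (hf : f ∈ classL d Ω S) {u : PartialFun Y} (hu : u ∈ K f) {x₀ : Y} {R : ℝ}
    (hR : 0 < R) (hΩ : qball d x₀ R ⊆ Ω) (hdom : qball d x₀ R ⊆ u.dom)
    (hSf : S (qball d x₀ R) f < ENNReal.ofReal (min ε₁ ε₂)) :
    HasGrowthOn d μ u.extend (qball d x₀ R) ν c γ (max η₁ η₂) := by
  -- Level `t` for `u` is level `1` for `t⁻¹ u`, which belongs to `t⁻¹ f`; as `t ≥ 1`, the size
  -- functional does not increase and stays below the threshold.
  have hscale : ∀ t : ℝ, 1 ≤ t → (fun y => t⁻¹ * f y) ∈ classL d Ω S ∧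
      u.smul t⁻¹ ∈ K (fun y => t⁻¹ * f y) ∧
      ∀ x r, 0 < r → qball d x r ⊆ qball d x₀ R →
        S (qball d x r) (fun y => t⁻¹ * f y) < ENNReal.ofReal (min ε₁ ε₂) := by
    intro t ht
    have ht0 : 0 ≤ t⁻¹ := by positivity
    have ht1 : ENNReal.ofReal |t⁻¹| ≤ 1 := by
      rw [abs_of_nonneg ht0, ENNReal.ofReal_le_one]
      exact inv_le_one_of_one_le₀ ht
    have hle : ∀ x r, 0 < r → qball d x r ⊆ Ω →
        S (qball d x r) (fun y => t⁻¹ * f y) ≤ S (qball d x r) f := fun x r hr hx => by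
      rw [hS.homog f hf.1 _ x r hr hx]
      exact mul_le_of_le_one_left bot_le ht1
    exact ⟨⟨hf.1.const_mul _, fun x r hr hx => (hle x r hr hx).trans_lt (hf.2 x r hr hx)⟩,
      hK.smul_mem f hf u hu _ ht0, fun x r hr hx => ((hle x r hr (hx.trans hΩ)).trans
        (hS.mono f hf.1 _ _ _ _ hr hR hΩ hx)).trans_lt hSf⟩
  constructor
  · intro x r t hr ht hD hdens y hy
    obtain ⟨hft, hut, hSt⟩ := hscale t ht
    have ht0 : 0 < t := by linarith
    have hsub : qball d x (η₁ * r) ⊆ qball d x₀ R :=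
      (qball_subset_qball (by gcongr; exact le_max_left _ _)).trans hD
    have hsub' : qball d x r ⊆ qball d x (η₁ * r) := qball_subset_qball (by nlinarith)
    have hyd : y ∈ u.dom :=
      hdom (hsub (hsub' (qball_subset_qball (by linarith) hy)))
    have h1 := (hCD _ hft x r hr (hsub.trans hΩ) _ hut (hsub.trans hdom) (hdens.trans
      (measure_mono fun z hz => ⟨hz.1, hdom (hsub (hsub' hz.1)), ?_⟩))).resolve_right
      (not_le.2 ((hSt x _ (by positivity) hsub).trans_le
        (ENNReal.ofReal_le_ofReal (min_le_left _ _))))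
    · have h2 : c ≤ t⁻¹ * u.toFun ⟨y, hyd⟩ := h1.trans
        (PartialFun.infOn_le (hK.nonneg _ hft _ hut) (u := u.smul t⁻¹) hyd hy)
      rw [PartialFun.extend_of_mem hyd]
      rwa [inv_mul_eq_div, le_div_iff₀ ht0] at h2
    · have h2 : t ≤ u.extend z := hz.2
      rw [PartialFun.extend_of_mem (hdom (hsub (hsub' hz.1)))] at h2
      change 1 ≤ t⁻¹ * _
      rwa [inv_mul_eq_div, one_le_div ht0]
  · intro x r t hr ht hD hUt y hy
    obtain ⟨hft, hut, hSt⟩ := hscale t ht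
    have ht0 : 0 < t := by linarith
    have hsub : qball d x (η₂ * r) ⊆ qball d x₀ R :=
      (qball_subset_qball (by gcongr; exact le_max_right _ _)).trans hD
    have hsub' : qball d x r ⊆ qball d x (η₂ * r) := qball_subset_qball (by nlinarith)
    have hyd : y ∈ u.dom := hdom (hsub (hsub' hy))
    have hsub2 : qball d x (r / 2) ⊆ u.dom :=
      (qball_subset_qball (by linarith)).trans (hsub'.trans (hsub.trans hdom))
    have h1 := hDB _ hft x r hr (hsub.trans hΩ) _ hut (hsub.trans hdom)
      (PartialFun.le_infOn ⟨x, hd.mem_qball_self x (by positivity)⟩ hsub2 fun z hzd hz => ?_)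
      ((hSt x _ (by positivity) hsub).trans_le (ENNReal.ofReal_le_ofReal (min_le_right _ _)))
    · have h2 : γ ≤ t⁻¹ * u.toFun ⟨y, hyd⟩ := h1.trans
        (PartialFun.infOn_le (hK.nonneg _ hft _ hut) (u := u.smul t⁻¹) hyd hy)
      rw [PartialFun.extend_of_mem hyd]
      rwa [inv_mul_eq_div, le_div_iff₀ ht0] at h2
    · have h2 := hUt z hz
      rw [PartialFun.extend_of_mem (u := u) hzd] at h2
      change 1 ≤ t⁻¹ * _
      rwa [inv_mul_eq_div, one_le_div ht0]

/-- The critical density and double ball properties imply the power decay property. -/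
theorem HasCriticalDensity.hasPowerDecay (hC : IsDoubling d μ C_D) (hd : IsHolderQuasiDist d)
    (hμ : IsRegularMeasure d μ) (hS : IsSizeFunctional d Ω S) (hK : IsAdmissibleFamily d Ω S K)
    {ν : ℝ} (hν₀ : 0 < ν) (hν₁ : ν < 1) (hCD : HasCriticalDensity d μ Ω S K ν)
    (hDB : HasDoubleBall d Ω S K) : HasPowerDecay d μ Ω S K := by
  by_cases hfin : ∀ x r, μ (qball d x r) ≠ ∞
  · obtain ⟨c, ε₁, η₁, hc₀, hc₁, hε₁, hε₁', hη₁, hCD⟩ := hCD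
    obtain ⟨γ, ε₂, η₂, hγ₀, hγ₁, hε₂, -, hη₂, hDB⟩ := hDB
    obtain ⟨M, P, hM, hP, hmain⟩ := exists_measure_superlevel_le hC hd hμ hfin hν₀ hν₁ hc₀ hc₁ hγ₀
      hγ₁ (lt_max_of_lt_left hη₁ : 1 < max η₁ η₂)
    refine ⟨M, 1 / 2, min ε₁ ε₂, P, hM, by norm_num, by norm_num, lt_min hε₁ hε₂,
      min_lt_of_left_lt hε₁', hP, fun f hf x₀ R hR hΩ u hu hdom hinf hSf k => ?_⟩
    have hRdom : qball d x₀ R ⊆ u.dom := (qball_subset_qball (by nlinarith)).trans hdom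
    rw [PartialFun.inter_strictSuperlevel ((qball_subset_qball (by linarith)).trans hRdom)]
    refine hmain x₀ R _ hR (hasGrowthOn_extend hd.toIsQuasiDist hS hK hη₁ hη₂ hCD hDB hf hu
      (by positivity) hΩ hdom hSf) (PartialFun.measurableSet_inter_extend
        (hK.measurable f hf u hu) (hμ.measurableSet_ball _ _) hRdom) (fun t ht => ?_) k
    obtain ⟨y, hy, hyB, hyt⟩ := PartialFun.exists_lt_of_infOn_lt
      ⟨x₀, hd.mem_qball_self x₀ hR⟩ hRdom (hinf.trans_lt ht)
    exact ⟨y, hyB, by rwa [PartialFun.extend_of_mem hy]⟩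
  -- Here every ball of positive radius has infinite measure, so the right-hand side is `∞` and any
  -- admissible constants do.
  · push Not at hfin
    obtain ⟨x, r, hxr⟩ := hfin
    refine ⟨2, 1 / 2, 1 / 2, 2, by norm_num, by norm_num, by norm_num, by norm_num, by norm_num,
      by norm_num, fun f _ x₀ R hR _ u _ _ _ _ k => ?_⟩
    have htop : μ (qball d x₀ (R / 2)) = ∞ := by
      by_contra hne
      exact hC.measure_qball_ne_top hd.toIsQuasiDist (half_pos hR) hne x r hxr
    rw [htop, ENNReal.mul_top (by simp)]
    exact le_top

end NonhomHarnack

theorem theorem2p1 {Y : Type*} [MeasurableSpace Y] (d : Y → Y → ℝ) (μ : Measure Y)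
    (hd : NonhomHarnack.IsHolderQuasiDist d) (hμ : NonhomHarnack.IsRegularMeasure d μ)
    (C_D : ℝ) (hC : NonhomHarnack.IsDoubling d μ C_D)
    (Ω : Set Y) (hΩ : NonhomHarnack.IsQOpen d Ω)
    (S : Set Y → (Ω → ℝ) → ℝ≥0∞) (hS : NonhomHarnack.IsSizeFunctional d Ω S)
    (K : (Ω → ℝ) → Set (NonhomHarnack.PartialFun Y)) (hK : NonhomHarnack.IsAdmissibleFamily d Ω S K)
    (δ : ℝ) (hδ₀ : 0 < δ) (hδ₁ : δ < 1)
    (hrev : ∀ x r, 0 < r → NonhomHarnack.qball d x (2 * r) ⊆ Ω →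
      μ (NonhomHarnack.qball d x r) ≤ ENNReal.ofReal δ * μ (NonhomHarnack.qball d x (2 * r)))
    (ν : ℝ) (hν₀ : 0 < ν) (hν₁ : ν < 1)
    (hAB :
      (NonhomHarnack.HasDoubleBall d Ω S K ∧ NonhomHarnack.HasCriticalDensity d μ Ω S K ν ∧
        ∃ ω : ℝ → ℝ, NonhomHarnack.RingCondition d μ ω ∧
          ω =o[𝓝[>] 0] fun s : ℝ => ((Real.log (1 / s)) ^ 2)⁻¹) ∨
      (NonhomHarnack.HasCriticalDensity d μ Ω S K ν ∧ ν < 1 / C_D ^ 2 ∧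
        ∀ x : Y, ContinuousOn (fun r : ℝ => μ (NonhomHarnack.qball d x r)) (Ioi 0))) :
    NonhomHarnack.HasPowerDecay d μ Ω S K := by
  rcases hAB with ⟨hDB, hCD, -⟩ | ⟨hCD, hν, -⟩
  · exact hCD.hasPowerDecay hC hd hμ hS hK hν₀ hν₁ hDB
  · exact hCD.hasPowerDecay hC hd hμ hS hK hν₀ hν₁
      (hCD.hasDoubleBall hC hK hν)
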